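/- Let $k\ge 2$, let $V_1,\dots,V_{k+1}$ be finite sets of the same size, and let $A$ be a hypermatrix indexed by $V_1\times\cdots\times V_k\times V_{k+1}$ with entries in a commutative ring. For each $1\le i\le k$ fix a bijection $V_{k+1}\to V_i$, by which $V_{k+1}$ is identified with $V_i$, and define $$\mathrm{per}(A)=\sum_{\alpha_1,\dots,\alpha_k}\ \prod_{w\in V_{k+1}}A_{(\alpha_1(w),\dots,\alpha_k(w),w)},\qquad \det(A)=\sum_{\alpha_1,\dots,\alpha_k}\Big(\prod_{j=1}^k\mathrm{sign}(\alpha_j)\Big)\prod_{w\in V_{k+1}}A_{(\alpha_1(w),\dots,\alpha_k(w),w)},$$ where each $\alpha_i$ runs over all permutations of $V_i$. For $1\le i\le k$ let $G_i$ be the bipartite graph with colour classes $V_{k+1}$ and $V_i$ (taken disjoint) in which $w\in V_{k+1}$ and $x\in V_i$ are adjacent if and only if there is a nonzero entry $A_{(v_1,\dots,v_{k+1})}\ne 0$ with $v_i=x$ and $v_{k+1}=w$. **Theorem.** If all the graphs $G_1,\dots,G_k$ are planar (that is, can be embedded in the plane with vertices as distinct points and edges as simple arcs that meet only in common endpoints),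 then $A$ is Kasteleyn: there is a hypermatrix $A'$, obtained from $A$ by changing the signs of some entries, such that $\mathrm{per}(A)=\det(A')$. -/

import Mathlib

/-- A proper embedding of a graph `G` in the Euclidean plane: vertices are distinct points, each
edge is a simple arc joining its two endpoints, an arc meets the vertex set only in the endpoints
of its edge, and two different arcs meet only in common endpoints of their edges. -/
structure PlaneEmbedding {X : Type*} (G : SimpleGraph X) where
  /-- the points representing the vertices -/
  point : X → EuclideanSpace ℝ (Fin 2)
  point_injective : Function.Injective point
  /-- the arcs representing the edges -/
  arc : G.edgeSet → C(unitInterval, EuclideanSpace ℝ (Fin 2))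
  arc_injective : ∀ e, Function.Injective (arc e)
  arc_endpoints : ∀ e : G.edgeSet, s(arc e 0, arc e 1) = Sym2.map point (e : Sym2 X)
  arc_vertex : ∀ (e : G.edgeSet) (t : unitInterval) (x : X),
    arc e t = point x → x ∈ (e : Sym2 X)
  arc_arc : ∀ (e f : G.edgeSet), e ≠ f → ∀ s t : unitInterval, arc e s = arc f t →
    ∃ x : X, x ∈ (e : Sym2 X) ∧ x ∈ (f : Sym2 X) ∧ arc e s = point x

/-- A graph is planar if it can be properly embedded in the plane. -/
def IsPlanar {X : Type*} (G : SimpleGraph X) : Prop := Nonempty (PlaneEmbedding G)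

/-- A `(k+1)`-matrix: an array with entries in `R` indexed by `V₁ × ⋯ × V_k × W`, where the family
`V` lists the first `k` index sets and `W` is the last index set `V_{k+1}`. -/
abbrev Hypermatrix {k : ℕ} (V : Fin k → Type*) (W R : Type*) := (∀ i : Fin k, V i) × W → R

namespace Hypermatrix

variable {k : ℕ} {V : Fin k → Type*} {W R : Type*}

/-- The permanent
`∑_{α₁, …, α_k} ∏_{w ∈ W} A (α₁ w, …, α_k w, w)` over permutations `α_i` of `V i`, where `W` is
identified with each `V i` through the given bijection `ref i`. -/
def per [∀ i, Fintype (V i)] [∀ i, DecidableEq (V i)] [Fintype W] [CommRing R]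
    (ref : ∀ i, W ≃ V i) (A : Hypermatrix V W R) : R :=
  ∑ α : (∀ i, Equiv.Perm (V i)), ∏ w : W, A (fun i => α i (ref i w), w)

/-- The determinant
`∑_{α₁, …, α_k} (∏_j sign α_j) ∏_{w ∈ W} A (α₁ w, …, α_k w, w)`, with the same conventions. -/
def det [∀ i, Fintype (V i)] [∀ i, DecidableEq (V i)] [Fintype W] [CommRing R]
    (ref : ∀ i, W ≃ V i) (A : Hypermatrix V W R) : R :=
  ∑ α : (∀ i, Equiv.Perm (V i)),
    (∏ j, (((Equiv.Perm.sign (α j) : ℤˣ) : ℤ) : R)) * ∏ w : W, A (fun i => α i (ref i w), w)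

/-- `A'` is a signing of `A`: it arises from `A` by changing the signs of some entries. -/
def IsSigning [CommRing R] (A' A : Hypermatrix V W R) : Prop :=
  ∀ v, A' v = A v ∨ A' v = -A v

/-- `A` is Kasteleyn if some signing `A'` of `A` satisfies `per A = det A'`. -/
def IsKasteleyn [∀ i, Fintype (V i)] [∀ i, DecidableEq (V i)] [Fintype W] [CommRing R]
    (ref : ∀ i, W ≃ V i) (A : Hypermatrix V W R) : Prop :=
  ∃ A' : Hypermatrix V W R, IsSigning A' A ∧ per ref A = det ref A'

/-- The bipartite graph `G_i` with colour classes `W` and `V i`: the vertices `w` and `x` are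
joined if some nonzero entry of `A` has last index `w` and `i`-th index `x`. -/
def bipartiteGraph [Zero R] (A : Hypermatrix V W R) (i : Fin k) : SimpleGraph (W ⊕ V i) where
  Adj
    | Sum.inl w, Sum.inr x => ∃ v : ∀ j, V j, v i = x ∧ A (v, w) ≠ 0
    | Sum.inr x, Sum.inl w => ∃ v : ∀ j, V j, v i = x ∧ A (v, w) ≠ 0
    | _, _ => False
  symm := ⟨by rintro (w | x) (w' | x') h <;> exact h⟩
  loopless := ⟨by rintro (w | x) h <;> exact h⟩

end Hypermatrix

/-!
The theorem reduces to Kasteleyn's theorem for bipartite planar graphs: if the edges of `G_i` carry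
signs `s_i` such that `sign α * ∏ w, s_i w (α w) = 1` for every perfect matching `α` of `G_i`, then
multiplying the entry of `A` at `(v, w)` by `∏ i, s_i w (v i)` turns the determinant into the
permanent, because a nonzero term of either sum consists of perfect matchings of all the `G_i`.

Kasteleyn's theorem is proved here for arbitrary continuous arcs, without faces and without the
Jordan curve theorem. Identify the plane with `ℂ`, let `p i` and `q j` be the points of the two
colour classes, and let `τ` be a perfect matching. Its sign is, up to a constant independent of `τ`,
`∏ (q (τ i') - q (τ i)) / (p i' - p i)` over the pairs `i < i'`, a quotient of Vandermonde
determinants. If `a` and `b` are the disjoint arcs of `i` and `i'`, then `a s - b t` has a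
continuous logarithm on the square, since the square is simply connected. Hence each factor of the
product is the exponential of half the total variation of the logarithms of `a - b 0`, `a - b 1`,
`b - a 0` and `b - a 1` (`exp_half_logVariation_of_disjoint`). Each of these four terms involves a
single arc and a vertex off it, so the product over all pairs becomes a product over the arcs of the
matching of weights `exp (arcPhase i j)`, and the weight of an arc does not depend on the rest of the
matching (`prod_exp_arcPhase`).

These weights are complex numbers, but their squares only depend on the end points of the arc:
`exp (arcPhase i j) ^ 2` is a function of `j` divided by a function of `i` (`exp_arcPhase_sq`). So
the weights are signs `s i j` times `β j / α i`. The factors `β j / α i` multiply up to the same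
constant for all perfect matchings, and the signs are those sought, up to a global sign that is
absorbed in one row.
-/

open unitInterval

noncomputable section

/-! ### Continuous logarithms along arcs -/

/-- A nowhere vanishing continuous function on the square has a continuous logarithm. It is first
extended to the plane by the retraction onto the square, then lifted through `Complex.exp`. -/
lemma exists_continuous_log_square (f : C(I × I, ℂ)) (hf : ∀ a, f a ≠ 0) :
    ∃ L : C(I × I, ℂ), ∀ a, Complex.exp (L a) = f a := by
  let r : C(ℝ × ℝ, I × I) :=
    ⟨fun x => (Set.projIcc 0 1 zero_le_one x.1, Set.projIcc 0 1 zero_le_one x.2),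
      (continuous_projIcc.comp continuous_fst).prodMk (continuous_projIcc.comp continuous_snd)⟩
  obtain ⟨F, ⟨-, hF⟩, -⟩ := Complex.isCoveringMapOn_exp.existsUnique_continuousMap_lifts
    (f.comp r) (a₀ := 0) (e₀ := Complex.log (f.comp r 0)) (Complex.exp_log (hf _))
    (fun a => by simpa using hf (r a))
  refine ⟨F.comp ⟨fun a => ((a.1 : ℝ), (a.2 : ℝ)), by fun_prop⟩, fun a => ?_⟩
  have h := congrFun hF ((a.1 : ℝ), (a.2 : ℝ))
  simpa [r, Set.projIcc_val] using h

lemma exists_continuous_log (γ : C(I, ℂ)) (hγ : ∀ t, γ t ≠ 0) :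
    ∃ L : C(I, ℂ), ∀ t, Complex.exp (L t) = γ t := by
  obtain ⟨L, hL⟩ := exists_continuous_log_square (γ.comp .fst) (fun a => hγ a.1)
  exact ⟨L.comp ⟨fun t => (t, 0), by fun_prop⟩, fun t => hL (t, 0)⟩

/-- The variation `L 1 - L 0` of a continuous logarithm `L` along the path `γ`, with junk value
`0` if `γ` has no continuous logarithm, that is, if it runs through `0`. -/
def logVariation (γ : C(I, ℂ)) : ℂ :=
  open Classical in
  if h : ∃ L : C(I, ℂ), ∀ t, Complex.exp (L t) = γ t then h.choose 1 - h.choose 0 else 0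

lemma logVariation_eq {γ L : C(I, ℂ)} (hL : ∀ t, Complex.exp (L t) = γ t) :
    logVariation γ = L 1 - L 0 := by
  have h : ∃ L : C(I, ℂ), ∀ t, Complex.exp (L t) = γ t := ⟨L, hL⟩
  rw [logVariation, dif_pos h]
  have h1 : ∀ t, Complex.exp (h.choose t - L t) = 1 := fun t => by
    rw [Complex.exp_sub, h.choose_spec t, hL t, div_self]
    rw [← hL t]
    exact Complex.exp_ne_zero _
  have key := Complex.isCoveringMap_exp.const_of_comp (A := I)
    (g := fun t => h.choose t - L t) (by fun_prop)
    (fun t t' => Subtype.ext ((h1 t).trans (h1 t').symm)) 1 0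
  linear_combination key

lemma exp_logVariation {γ : C(I, ℂ)} (hγ : ∀ t, γ t ≠ 0) :
    Complex.exp (logVariation γ) = γ 1 / γ 0 := by
  obtain ⟨L, hL⟩ := exists_continuous_log γ hγ
  rw [logVariation_eq hL, Complex.exp_sub, hL, hL]

/-- For disjoint arcs `a` and `b`, the logarithm of `a s - b t` is a function on the square, so its
variation along the diagonal is the one along either pair of consecutive sides. Averaging the two
expresses it through the motion of each arc around the end points of the other. -/
lemma exp_half_logVariation_of_disjoint (a b : C(I, ℂ)) (hab : ∀ s t, a s ≠ b t) :
    Complex.exp ((logVariation (a - .const I (b 0)) + logVariation (a - .const I (b 1)) +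
      (logVariation (b - .const I (a 0)) + logVariation (b - .const I (a 1)))) / 2) =
      (a 1 - b 1) / (a 0 - b 0) := by
  obtain ⟨L, hL⟩ := exists_continuous_log_square (a.comp .fst - b.comp .snd)
    (fun x => sub_ne_zero.2 (hab x.1 x.2))
  replace hL : ∀ s t, Complex.exp (L (s, t)) = a s - b t := fun s t => hL (s, t)
  have ha : ∀ t, logVariation (a - .const I (b t)) = L (1, t) - L (0, t) := fun t =>
    logVariation_eq (L := L.comp ⟨fun s => (s, t), by fun_prop⟩) (fun s => hL s t)
  have hb : ∀ s, logVariation (b - .const I (a s)) = L (s, 1) - L (s, 0) := fun s => by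
    -- the summand `π * I` turns `a s - b t` into `b t - a s`
    rw [logVariation_eq (L := ⟨fun t => L (s, t) + Real.pi * Complex.I, by fun_prop⟩)]
    · simp
    · intro t
      simp [Complex.exp_add, hL, Complex.exp_pi_mul_I]
  rw [ha, ha, hb, hb, ← hL, ← hL, ← Complex.exp_sub]
  congr 1
  ring

/-! ### Signing the edges -/

lemma exists_units_int_mul_div {z α β : ℂ} (h : z ^ 2 = (β / α) ^ 2) :
    ∃ u : ℤˣ, z = ((u : ℤ) : ℂ) * (β / α) := by
  rcases sq_eq_sq_iff_eq_or_eq_neg.1 h with h | h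
  · exact ⟨1, by simpa using h⟩
  · exact ⟨-1, by simpa using h⟩

section
variable {n : ℕ} (p q : Fin n → ℂ) (a : Fin n → Fin n → C(I, ℂ))

/-- Half the total variation of the logarithm of `a i j t - u`, where `u` runs through all points
`p i'` and `q j'` other than the end points `p i` and `q j` of the arc `a i j`. -/
def arcPhase (i j : Fin n) : ℂ :=
  (∑ i' ∈ {i}ᶜ, logVariation (a i j - .const I (p i')) +
    ∑ j' ∈ {j}ᶜ, logVariation (a i j - .const I (q j'))) / 2

variable {p q a}

/-- The square of `exp (arcPhase p q a i j)` is a function of `i` times a function of `j`. -/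
lemma exp_arcPhase_sq (hp : Function.Injective p)
    (hpq : ∀ i j, p i ≠ q j) {i j : Fin n} (h0 : a i j 0 = p i) (h1 : a i j 1 = q j)
    (hap : ∀ t i', i' ≠ i → a i j t ≠ p i') (haq : ∀ t j', j' ≠ j → a i j t ≠ q j') :
    Complex.exp (arcPhase p q a i j) ^ 2 =
      -((∏ i', (q j - p i')) * ∏ j' ∈ {j}ᶜ, (q j - q j')) /
        ((∏ i' ∈ {i}ᶜ, (p i - p i')) * ∏ j', (p i - q j')) := by
  have e1 : ∀ i' ∈ ({i}ᶜ : Finset (Fin n)),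
      Complex.exp (logVariation (a i j - .const I (p i'))) = (q j - p i') / (p i - p i') := by
    intro i' hi'
    rw [exp_logVariation]
    · simp [h0, h1]
    · intro t
      exact sub_ne_zero.2 (hap t i' (by simpa using hi'))
  have e2 : ∀ j' ∈ ({j}ᶜ : Finset (Fin n)),
      Complex.exp (logVariation (a i j - .const I (q j'))) = (q j - q j') / (p i - q j') := by
    intro j' hj'
    rw [exp_logVariation]
    · simp [h0, h1]
    · intro t
      exact sub_ne_zero.2 (haq t j' (by simpa using hj'))
  have hP : ∏ i', (q j - p i') = (q j - p i) * ∏ i' ∈ {i}ᶜ, (q j - p i') := by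
    rw [← Finset.mul_prod_erase _ _ (Finset.mem_univ i)]; congr 2; ext; simp
  have hQ : ∏ j', (p i - q j') = (p i - q j) * ∏ j' ∈ {j}ᶜ, (p i - q j') := by
    rw [← Finset.mul_prod_erase _ _ (Finset.mem_univ j)]; congr 2; ext; simp
  rw [← Complex.exp_nat_mul, arcPhase, Nat.cast_ofNat, mul_div_cancel₀ _ two_ne_zero,
    Complex.exp_add, Complex.exp_sum, Complex.exp_sum, Finset.prod_congr rfl e1,
    Finset.prod_congr rfl e2, Finset.prod_div_distrib, Finset.prod_div_distrib, hP, hQ]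
  have n1 : ∏ i' ∈ {i}ᶜ, (p i - p i') ≠ 0 := Finset.prod_ne_zero_iff.2 fun i' hi' =>
    sub_ne_zero.2 fun h => by simp [hp h] at hi'
  have n2 : ∏ j' ∈ {j}ᶜ, (p i - q j') ≠ 0 := Finset.prod_ne_zero_iff.2 fun j' _ =>
    sub_ne_zero.2 (hpq i j')
  have n3 := sub_ne_zero.2 (hpq i j)
  field_simp
  ring

/-- For a perfect matching `τ` by disjoint arcs, the phases multiply up to a quotient of
Vandermonde determinants. -/
lemma prod_exp_arcPhase (τ : Equiv.Perm (Fin n)) (h0 : ∀ i, a i (τ i) 0 = p i)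
    (h1 : ∀ i, a i (τ i) 1 = q (τ i))
    (hd : ∀ i i', i ≠ i' → ∀ s t, a i (τ i) s ≠ a i' (τ i') t) :
    ∏ i, Complex.exp (arcPhase p q a i (τ i)) =
      ((Equiv.Perm.sign τ : ℤ) : ℂ) *
        ((Matrix.vandermonde q).det / (Matrix.vandermonde p).det) := by
  have hv : ((Equiv.Perm.sign τ : ℤ) : ℂ) * (Matrix.vandermonde q).det =
      (Matrix.vandermonde (q ∘ τ)).det := by
    rw [← Matrix.det_permute]; rfl
  rw [← mul_div_assoc, hv, Matrix.det_vandermonde, Matrix.det_vandermonde,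
    ← Finset.prod_div_distrib]
  simp_rw [← Finset.prod_div_distrib]
  let H : Fin n → Fin n → ℂ := fun i' i =>
    logVariation (a i (τ i) - .const I (p i')) + logVariation (a i (τ i) - .const I (q (τ i')))
  have hH : ∀ i, arcPhase p q a i (τ i) = (∑ i' ∈ {i}ᶜ, H i' i) / 2 := by
    intro i
    rw [arcPhase, Finset.sum_add_distrib]
    congr 2
    refine (Finset.sum_equiv τ ?_ fun _ _ => rfl).symm
    simp
  rw [← Complex.exp_sum, Finset.sum_congr rfl fun i _ => hH i, ← Finset.sum_div,
    ← Finset.sum_sum_Ioi_add_eq_sum_sum_off_diag, Finset.sum_div, Complex.exp_sum]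
  refine Finset.prod_congr rfl fun i _ => ?_
  rw [Finset.sum_div, Complex.exp_sum]
  refine Finset.prod_congr rfl fun j hj => ?_
  have hij : j ≠ i := (Finset.mem_Ioi.1 hj).ne'
  have := exp_half_logVariation_of_disjoint (a j (τ j)) (a i (τ i)) (hd j i hij)
  rw [h0, h0, h1, h1] at this
  rw [Function.comp_apply, Function.comp_apply, ← this]
  congr 2
  simp only [H]
  ring

end

/-- A bipartite graph with colour classes of size `n`, drawn in the plane by arcs that are disjoint
from all other vertices and from all arcs without a common end point, has a signing for which
the signs along every perfect matching multiply up to the sign of the corresponding permutation. -/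
theorem exists_signing_of_arcs {n : ℕ} (E : Fin n → Fin n → Prop) (p q : Fin n → ℂ)
    (a : Fin n → Fin n → C(I, ℂ)) (hp : Function.Injective p) (hq : Function.Injective q)
    (hpq : ∀ i j, p i ≠ q j) (h0 : ∀ i j, E i j → a i j 0 = p i)
    (h1 : ∀ i j, E i j → a i j 1 = q j)
    (hap : ∀ i j, E i j → ∀ t i', i' ≠ i → a i j t ≠ p i')
    (haq : ∀ i j, E i j → ∀ t j', j' ≠ j → a i j t ≠ q j')
    (hd : ∀ i j i' j', E i j → E i' j' → i ≠ i' → j ≠ j' → ∀ s t, a i j s ≠ a i' j' t) :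
    ∃ s : Fin n → Fin n → ℤˣ, ∀ τ : Equiv.Perm (Fin n), (∀ i, E i (τ i)) →
      Equiv.Perm.sign τ * ∏ i, s i (τ i) = 1 := by
  choose α hα using fun i => IsAlgClosed.exists_pow_nat_eq
    ((∏ i' ∈ {i}ᶜ, (p i - p i')) * ∏ j', (p i - q j')) two_pos
  choose β hβ using fun j => IsAlgClosed.exists_pow_nat_eq
    (-((∏ i', (q j - p i')) * ∏ j' ∈ {j}ᶜ, (q j - q j'))) two_pos
  have hs : ∀ i j, ∃ u : ℤˣ, E i j →
      Complex.exp (arcPhase p q a i j) = ((u : ℤ) : ℂ) * (β j / α i) := by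
    intro i j
    by_cases h : E i j
    · obtain ⟨u, hu⟩ := exists_units_int_mul_div (z := Complex.exp (arcPhase p q a i j))
        (β := β j) (α := α i) (by
          rw [exp_arcPhase_sq hp hpq (h0 i j h) (h1 i j h) (hap i j h) (haq i j h), div_pow,
            hα, hβ])
      exact ⟨u, fun _ => hu⟩
    · exact ⟨1, fun h' => absurd h' h⟩
  choose s hs using hs
  let c := (Matrix.vandermonde q).det / (Matrix.vandermonde p).det
  have hc : c ≠ 0 := div_ne_zero (Matrix.det_vandermonde_ne_zero_iff.2 hq)
    (Matrix.det_vandermonde_ne_zero_iff.2 hp)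
  let κ := (∏ j, β j) / ∏ i, α i
  have key : ∀ τ : Equiv.Perm (Fin n), (∀ i, E i (τ i)) →
      ((Equiv.Perm.sign τ : ℤ) : ℂ) * c = ((∏ i, s i (τ i) : ℤˣ) : ℤ) * κ := by
    intro τ hτ
    rw [← prod_exp_arcPhase τ (fun i => h0 _ _ (hτ i)) (fun i => h1 _ _ (hτ i))
      (fun i i' h => hd _ _ _ _ (hτ i) (hτ i') h (τ.injective.ne h)),
      Finset.prod_congr rfl fun i _ => hs i (τ i) (hτ i), Finset.prod_mul_distrib,
      Finset.prod_div_distrib, Equiv.prod_comp τ β]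
    simp [κ]
  -- all perfect matchings have the same sign up to the signing
  have hconst : ∃ ε : ℤˣ, ∀ τ : Equiv.Perm (Fin n), (∀ i, E i (τ i)) →
      Equiv.Perm.sign τ * ∏ i, s i (τ i) = ε := by
    by_cases hE : ∃ τ : Equiv.Perm (Fin n), ∀ i, E i (τ i)
    · obtain ⟨τ₀, h₀⟩ := hE
      refine ⟨Equiv.Perm.sign τ₀ * ∏ i, s i (τ₀ i), fun τ hτ => ?_⟩
      have e₀ := key τ₀ h₀
      have e := key τ hτ
      have hκ : κ ≠ 0 := by
        rintro h
        rw [h, mul_zero] at e₀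
        rcases Int.units_eq_one_or (Equiv.Perm.sign τ₀) with h' | h' <;> simp [h', hc] at e₀
      generalize (∏ i, s i (τ i)) = u at *
      generalize (∏ i, s i (τ₀ i)) = u₀ at *
      have e' : ((Equiv.Perm.sign τ : ℤ) : ℂ) * (u₀ : ℤ) = (Equiv.Perm.sign τ₀ : ℤ) * (u : ℤ) :=
        mul_right_cancel₀ (mul_ne_zero hc hκ) (by linear_combination κ * u₀ * e - κ * u * e₀)
      have e'' : Equiv.Perm.sign τ * u₀ = Equiv.Perm.sign τ₀ * u := Units.ext (by exact_mod_cast e')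
      calc Equiv.Perm.sign τ * u = Equiv.Perm.sign τ * u₀ * u₀ * u := by
            rw [mul_assoc _ u₀ u₀, Int.units_mul_self, mul_one]
        _ = Equiv.Perm.sign τ₀ * u₀ * (u * u) := by rw [e'']; ac_rfl
        _ = _ := by rw [Int.units_mul_self, mul_one]
    · exact ⟨1, fun τ hτ => absurd ⟨τ, hτ⟩ hE⟩
  obtain ⟨ε, hε⟩ := hconst
  rcases n with _ | n
  · exact ⟨s, fun τ _ => by simp [Subsingleton.elim τ 1]⟩
  -- the common sign is removed by changing all signs in one row
  · refine ⟨fun i j => (if i = 0 then ε else 1) * s i j, fun τ hτ => ?_⟩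
    rw [Finset.prod_mul_distrib, Finset.prod_ite_eq' Finset.univ (0 : Fin (n + 1)) fun _ => ε,
      if_pos (Finset.mem_univ _), mul_left_comm, hε τ hτ, Int.units_mul_self]

/-! ### Planar graphs and hypermatrices -/

/-- Planarity, with the plane identified with `ℂ` and with every edge `wx` oriented from `w` to `x`.
-/
lemma IsPlanar.exists_arcs {X : Type*} {G : SimpleGraph X} (hG : IsPlanar G) :
    ∃ (P : X → ℂ) (a : X → X → C(I, ℂ)), Function.Injective P ∧
      (∀ w x, G.Adj w x → a w x 0 = P w ∧ a w x 1 = P x) ∧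
      (∀ w x, G.Adj w x → ∀ t y, a w x t = P y → y = w ∨ y = x) ∧
      ∀ w x w' x', G.Adj w x → G.Adj w' x' → w ≠ w' → w ≠ x' → x ≠ w' → x ≠ x' →
        ∀ s t, a w x s ≠ a w' x' t := by
  obtain ⟨D⟩ := hG
  let c := Complex.orthonormalBasisOneI.repr.symm
  have hc : Function.Injective c := c.injective
  have h : ∀ w x, ∃ b : C(I, ℂ), ∀ h : G.Adj w x, b 0 = c (D.point w) ∧ b 1 = c (D.point x) ∧
      ∀ t, ∃ t', b t = c (D.arc ⟨s(w, x), h⟩ t') := by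
    intro w x
    by_cases h : G.Adj w x
    · have he := D.arc_endpoints ⟨s(w, x), h⟩
      rw [Sym2.map_mk, Sym2.eq_iff] at he
      rcases he with ⟨e0, e1⟩ | ⟨e0, e1⟩
      · exact ⟨⟨fun t => c (D.arc ⟨s(w, x), h⟩ t), by fun_prop⟩, fun _ =>
          ⟨congrArg c e0, congrArg c e1, fun t => ⟨t, rfl⟩⟩⟩
      · refine ⟨⟨fun t => c (D.arc ⟨s(w, x), h⟩ (unitInterval.symm t)), by fun_prop⟩, fun _ =>
          ⟨?_, ?_, fun t => ⟨unitInterval.symm t, rfl⟩⟩⟩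
        · simp [e1]
        · simp [e0]
    · exact ⟨0, fun h' => absurd h' h⟩
  choose a ha using h
  refine ⟨fun x => c (D.point x), a, hc.comp D.point_injective,
    fun w x h => ⟨(ha w x h).1, (ha w x h).2.1⟩, fun w x h t y hy => ?_,
    fun w x w' x' h h' h1 h2 h3 h4 s t hst => ?_⟩
  · obtain ⟨t', ht'⟩ := (ha w x h).2.2 t
    exact Sym2.mem_iff.1 (D.arc_vertex ⟨s(w, x), h⟩ t' y (hc (ht'.symm.trans hy)))
  · obtain ⟨s', hs'⟩ := (ha w x h).2.2 s
    obtain ⟨t', ht'⟩ := (ha w' x' h').2.2 t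
    have hne : (⟨s(w, x), h⟩ : G.edgeSet) ≠ ⟨s(w', x'), h'⟩ := fun heq => by
      rcases Sym2.eq_iff.1 (congrArg Subtype.val heq) with ⟨e, -⟩ | ⟨e, -⟩
      exacts [h1 e, h2 e]
    obtain ⟨y, hy, hy', -⟩ := D.arc_arc ⟨s(w, x), h⟩ ⟨s(w', x'), h'⟩ hne s' t'
      (hc (hs'.symm.trans (hst.trans ht')))
    rcases Sym2.mem_iff.1 hy with rfl | rfl <;> rcases Sym2.mem_iff.1 hy' with rfl | rfl <;>
      contradiction

/-- **Kasteleyn's theorem** for bipartite planar graphs: there is a signing of the edges for which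
the signs along each perfect matching multiply up to the sign of the permutation it defines. -/
theorem IsPlanar.exists_kasteleyn_signing {W V : Type*} [Fintype W] [Fintype V] [DecidableEq V]
    (ref : W ≃ V) {G : SimpleGraph (W ⊕ V)} (hG : IsPlanar G) :
    ∃ s : W → V → ℤˣ, ∀ τ : Equiv.Perm V, (∀ w, G.Adj (.inl w) (.inr (τ (ref w)))) →
      Equiv.Perm.sign τ * ∏ w, s w (τ (ref w)) = 1 := by
  obtain ⟨P, a, hP, hend, hvert, hdisj⟩ := hG.exists_arcs
  let e := (Fintype.equivFin W).symm
  let f := e.trans ref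
  obtain ⟨s, hs⟩ := exists_signing_of_arcs (fun i j => G.Adj (.inl (e i)) (.inr (f j)))
    (fun i => P (.inl (e i))) (fun j => P (.inr (f j)))
    (fun i j => a (.inl (e i)) (.inr (f j)))
    (hP.comp (Sum.inl_injective.comp e.injective)) (hP.comp (Sum.inr_injective.comp f.injective))
    (fun i j h => Sum.inl_ne_inr (hP h)) (fun i j h => (hend _ _ h).1)
    (fun i j h => (hend _ _ h).2)
    (fun i j h t i' hi ht => by simpa [hi] using hvert _ _ h t _ ht)
    (fun i j h t j' hj ht => by simpa [hj] using hvert _ _ h t _ ht)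
    (fun i j i' j' h h' hi hj => hdisj _ _ _ _ h h' (by simpa using hi) (by simp) (by simp)
      (by simpa using hj))
  refine ⟨fun w x => s (e.symm w) (f.symm x), fun τ hτ => ?_⟩
  have := hs (f.symm.permCongr τ) (fun i => by simpa [Equiv.permCongr_apply, f] using hτ (e i))
  rw [Equiv.Perm.sign_permCongr] at this
  rw [← this, ← e.prod_comp]
  simp [Equiv.permCongr_apply, f]

end

theorem mainTheorem5 {k : ℕ} (hk : 2 ≤ k) {V : Fin k → Type*} {W R : Type*}
    [∀ i, Fintype (V i)] [∀ i, DecidableEq (V i)] [Fintype W] [CommRing R]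
    (ref : ∀ i, W ≃ V i) (A : Hypermatrix V W R)
    (hA : ∀ i : Fin k, IsPlanar (Hypermatrix.bipartiteGraph A i)) :
    Hypermatrix.IsKasteleyn ref A := by
  choose s hs using fun i => (hA i).exists_kasteleyn_signing (ref i)
  -- each entry takes the product of the signs of its `k` edges
  refine ⟨fun v => (((∏ i, s i v.2 (v.1 i) : ℤˣ) : ℤ) : R) * A v, fun v => ?_, ?_⟩
  · rcases Int.units_eq_one_or (∏ i, s i v.2 (v.1 i)) with h | h <;> simp [h]
  · refine Finset.sum_congr rfl fun α _ => ?_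
    by_cases h : ∃ w, A (fun i => α i (ref i w), w) = 0
    · obtain ⟨w, hw⟩ := h
      rw [Finset.prod_eq_zero (Finset.mem_univ w) hw,
        Finset.prod_eq_zero (Finset.mem_univ w) (by simp [hw]), mul_zero]
    · push Not at h
      have h1 : (∏ j, Equiv.Perm.sign (α j)) * ∏ w, ∏ j, s j w (α j (ref j w)) = 1 := by
        rw [Finset.prod_comm, ← Finset.prod_mul_distrib]
        exact Finset.prod_eq_one fun j _ => hs j (α j) fun w => ⟨_, rfl, h w⟩
      have hh := congrArg (fun u : ℤˣ => ((u : ℤ) : R)) h1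
      rw [Finset.prod_mul_distrib, ← mul_assoc]
      simp only [Units.val_mul, Units.coe_prod, Int.cast_mul, Int.cast_prod, Units.val_one,
        Int.cast_one] at hh ⊢
      rw [hh, one_mul]
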